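/- All Lie algebras are over $\mathbb{C}$. Let $\mathfrak g$ be a finite-dimensional simple complex Lie algebra and let $\Phi: SL_2(\mathbb{C})\to \operatorname{Aut}(\mathfrak g)$ be a homomorphism of algebraic groups which is a short $SL_2$-structure, i.e. its differential $d\Phi$, a representation of $\mathfrak{sl}_2=\mathfrak{sl}_2(\mathbb C)$ on $\mathfrak g$, decomposes into irreducible representations of dimensions $1$, $2$ and $3$. Let $$\mathfrak g=\mathfrak g_0\oplus(\mathbb C^2\otimes J_1)\oplus(\mathfrak{sl}_2\otimes J_2)$$ be the isotypic decomposition, where $\mathfrak g_0=\{x : d\Phi(\mathfrak{sl}_2)x=0\}$ and $J_1=\operatorname{Hom}_{\mathfrak{sl}_2}(\mathbb C^2,\mathfrak g)$, $J_2=\operatorname{Hom}_{\mathfrak{sl}_2}(\mathfrak{sl}_2,\mathfrak g)$ are the multiplicity spaces of the tautological and of the adjoint representation ($u\otimes a=a(u)$, $X\otimes A=A(X)$). Theorem. There are unique bilinear maps $J_2\times J_1\to J_1$, $(A,b)\mapsto Ab$, $\ \circ: J_2\times J_2\to J_2$ and $\Delta: J_2\times J_2\to\mathfrak g_0$ such that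 $$[X\otimes A, v\otimes b]=Xv\otimes Ab,\qquad [X\otimes A,Y\otimes B]=[X,Y]\otimes(A\circ B)+\tfrac12\operatorname{tr}(XY)\,\Delta(A,B)$$ for all $X,Y\in\mathfrak{sl}_2$, $v\in\mathbb C^2$, $A,B\in J_2$, $b\in J_1$. The algebra $(J_2,\circ)$ (the Jordan algebra of the structure) has a unique unit element $\mathbb I$, and $\mathbb I$ acts on $J_1$ as the identity operator: $\mathbb I a=a$ for all $a\in J_1$. -/

import Mathlib

attribute [local instance 100] LieRing.ofAssociativeRing

/-- The algebraic group `SL₂(ℂ)`. -/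
abbrev SL2 : Type := Matrix.SpecialLinearGroup (Fin 2) ℂ

/-- The Lie algebra `𝔰𝔩₂(ℂ)` of traceless matrices. -/
abbrev Sl2 : LieSubalgebra ℂ (Matrix (Fin 2) (Fin 2) ℂ) := LieAlgebra.SpecialLinear.sl (Fin 2) ℂ

/-- The exponential of a traceless `2 × 2` matrix has determinant one. -/
theorem det_exp_of_trace_eq_zero (X : Matrix (Fin 2) (Fin 2) ℂ) (hX : X.trace = 0) :
    (NormedSpace.exp X).det = 1 := by
  have key : ∀ Y : Matrix (Fin 2) (Fin 2) ℂ, Y.trace = 0 →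
      (NormedSpace.exp Y).det * (NormedSpace.exp Y).det = 1 := by
    intro Y hY
    set J : Matrix (Fin 2) (Fin 2) ℂ := !![0, 1; -1, 0] with hJ
    have hJd : J.det = 1 := by simp [hJ, Matrix.det_fin_two]
    have hJu : IsUnit J := (Matrix.isUnit_iff_isUnit_det J).2 (by simp [hJd])
    have htr : Y 1 1 = -Y 0 0 := by
      rw [Matrix.trace_fin_two] at hY
      linear_combination hY
    have hconj : J * Y.transpose * J⁻¹ = -Y := by
      have hmul : J * Y.transpose = -Y * J := by
        ext i j
        fin_cases i <;> fin_cases j <;> simp [hJ, Matrix.mul_apply, Fin.sum_univ_two, htr]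
      rw [hmul, Matrix.mul_assoc, Matrix.mul_nonsing_inv _ (by simp [hJd]), Matrix.mul_one]
    have h1 : (NormedSpace.exp (-Y)).det = (NormedSpace.exp Y).det := by
      rw [← hconj, Matrix.exp_conj J _ hJu, Matrix.exp_transpose, Matrix.det_mul, Matrix.det_mul,
        Matrix.det_transpose, Matrix.det_nonsing_inv, hJd]
      simp
    have h2 : NormedSpace.exp Y * NormedSpace.exp (-Y) = 1 := by
      rw [← Matrix.exp_add_of_commute _ _ (Commute.neg_right (Commute.refl Y))]
      simp
    calc (NormedSpace.exp Y).det * (NormedSpace.exp Y).det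
        = (NormedSpace.exp Y * NormedSpace.exp (-Y)).det := by rw [Matrix.det_mul, h1]
      _ = 1 := by rw [h2, Matrix.det_one]
  have hhalf : NormedSpace.exp X
      = NormedSpace.exp ((2⁻¹ : ℂ) • X) * NormedSpace.exp ((2⁻¹ : ℂ) • X) := by
    rw [← Matrix.exp_add_of_commute _ _ (Commute.refl _), ← add_smul]
    norm_num
  rw [hhalf, Matrix.det_mul]
  exact key _ (by simp [hX])

/-- The one-parameter subgroup `t ↦ exp (tX)` of `SL₂(ℂ)` with tangent vector `X ∈ 𝔰𝔩₂(ℂ)`. -/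
noncomputable def oneParam (X : Sl2) (t : ℂ) : SL2 :=
  ⟨NormedSpace.exp (t • (X : Matrix (Fin 2) (Fin 2) ℂ)),
    det_exp_of_trace_eq_zero _ (by
      have hX : (X : Matrix (Fin 2) (Fin 2) ℂ).trace = 0 := X.2
      simp [hX])⟩

/-- The entries of `exp (tX)` are differentiable in `t`. -/
theorem differentiable_oneParam_entry (X : Sl2) (i j : Fin 2) :
    Differentiable ℂ (fun t : ℂ => (oneParam X t).1 i j) := by
  intro t
  let _ : NormedRing (Matrix (Fin 2) (Fin 2) ℂ) := Matrix.linftyOpNormedRing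
  let _ : NormedAlgebra ℂ (Matrix (Fin 2) (Fin 2) ℂ) := Matrix.linftyOpNormedAlgebra
  have h := (hasDerivAt_exp_smul_const (𝕂 := ℂ) (X : Matrix (Fin 2) (Fin 2) ℂ) t).differentiableAt
  have hl := (LinearMap.toContinuousLinearMap
    ((LinearMap.proj j : (Fin 2 → ℂ) →ₗ[ℂ] ℂ) ∘ₗ
      (LinearMap.proj i : (Fin 2 → Fin 2 → ℂ) →ₗ[ℂ] (Fin 2 → ℂ)) ∘ₗ
      (Matrix.ofLinearEquiv ℂ).symm.toLinearMap)).differentiableAt.comp t h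
  exact hl

/-- An `SL₂`-structure on a complex Lie algebra `𝔤`: a homomorphism of algebraic groups
`Φ : SL₂(ℂ) → Aut 𝔤`. It is algebraic in the sense that each matrix coefficient `ℓ (Φ s x)` is a
polynomial in the four entries of `s`. -/
structure SL2Structure (𝔤 : Type*) [LieRing 𝔤] [LieAlgebra ℂ 𝔤] where
  toAut : SL2 → (𝔤 ≃ₗ⁅ℂ⁆ 𝔤)
  toAut_mul : ∀ (s t : SL2) (x : 𝔤), toAut (s * t) x = toAut s (toAut t x)
  algebraic : ∀ (ℓ : Module.Dual ℂ 𝔤) (x : 𝔤), ∃ p : MvPolynomial (Fin 2 × Fin 2) ℂ,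
    ∀ s : SL2, ℓ (toAut s x) = MvPolynomial.eval (fun ij => s.1 ij.1 ij.2) p

namespace SL2Structure

variable {𝔤 : Type*} [LieRing 𝔤] [LieAlgebra ℂ 𝔤] [FiniteDimensional ℂ 𝔤] (Φ : SL2Structure 𝔤)

/-- The differential `dΦ` of `Φ`, that is `dΦ(X) = d/dt Φ(exp tX)` at `t = 0` for `X ∈ 𝔰𝔩₂`.
The derivative of the operator-valued function is taken entrywise in a basis of `𝔤`; by
`hasDerivAt_differential` below the choice of the basis is immaterial. -/
noncomputable def differential (X : Sl2) : Module.End ℂ 𝔤 :=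
  Matrix.toLin (Module.finBasis ℂ 𝔤) (Module.finBasis ℂ 𝔤)
    (Matrix.of fun i j => deriv (fun t : ℂ =>
      LinearMap.toMatrix (Module.finBasis ℂ 𝔤) (Module.finBasis ℂ 𝔤)
        ((Φ.toAut (oneParam X t)).toLinearEquiv : 𝔤 →ₗ[ℂ] 𝔤) i j) 0)

/-- Every matrix coefficient of `dΦ(X)` is the derivative at `t = 0` of the corresponding matrix
coefficient of `Φ(exp tX)`. -/
theorem hasDerivAt_differential (X : Sl2) (x : 𝔤) (ℓ : Module.Dual ℂ 𝔤) :
    HasDerivAt (fun t : ℂ => ℓ (Φ.toAut (oneParam X t) x)) (ℓ (Φ.differential X x)) 0 := by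
  have hdiff : ∀ (ℓ' : Module.Dual ℂ 𝔤) (y : 𝔤),
      DifferentiableAt ℂ (fun t : ℂ => ℓ' (Φ.toAut (oneParam X t) y)) 0 := by
    intro ℓ' y
    obtain ⟨p, hp⟩ := Φ.algebraic ℓ' y
    simp only [hp]
    clear hp
    induction p using MvPolynomial.induction_on with
    | C a => simp
    | add p q hp hq => simp only [map_add]; exact hp.fun_add hq
    | mul_X p ij hp =>
      simp only [map_mul, MvPolynomial.eval_X]
      exact hp.fun_mul (differentiable_oneParam_entry X ij.1 ij.2 0)
  set b := Module.finBasis ℂ 𝔤 with hb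
  have hexp : ∀ T : 𝔤 →ₗ[ℂ] 𝔤, ℓ (T x) =
      ∑ i, ∑ j, LinearMap.toMatrix b b T i j * (b.repr x j * ℓ (b i)) := by
    intro T
    conv_lhs => rw [← b.sum_repr (T x), map_sum]
    refine Finset.sum_congr rfl fun i _ => ?_
    have : b.repr (T x) i = ∑ j, LinearMap.toMatrix b b T i j * b.repr x j := by
      rw [← LinearMap.toMatrix_mulVec_repr b b T x]
      rfl
    rw [map_smul, this, smul_eq_mul, Finset.sum_mul]
    exact Finset.sum_congr rfl fun j _ => by ring
  have h1 : (fun t : ℂ => ℓ (Φ.toAut (oneParam X t) x)) = fun t : ℂ =>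
      ∑ i, ∑ j, LinearMap.toMatrix b b
        ((Φ.toAut (oneParam X t)).toLinearEquiv : 𝔤 →ₗ[ℂ] 𝔤) i j * (b.repr x j * ℓ (b i)) :=
    funext fun t => hexp ((Φ.toAut (oneParam X t)).toLinearEquiv : 𝔤 →ₗ[ℂ] 𝔤)
  rw [h1, hexp (Φ.differential X)]
  refine HasDerivAt.fun_sum fun i _ => HasDerivAt.fun_sum fun j _ => HasDerivAt.mul_const ?_ _
  have h2 : LinearMap.toMatrix b b (Φ.differential X) i j = deriv (fun t : ℂ =>
      LinearMap.toMatrix b b ((Φ.toAut (oneParam X t)).toLinearEquiv : 𝔤 →ₗ[ℂ] 𝔤) i j) 0 := by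
    rw [differential, LinearMap.toMatrix_toLin]
    rfl
  rw [h2]
  refine DifferentiableAt.hasDerivAt ?_
  have := hdiff (b.coord i) (b j)
  simpa [LinearMap.toMatrix_apply] using this

/-- A subspace of `𝔤` that is invariant under `dΦ(𝔰𝔩₂)`. -/
def IsInvariant (W : Submodule ℂ 𝔤) : Prop :=
  ∀ X : Sl2, ∀ x ∈ W, Φ.differential X x ∈ W

/-- A nonzero invariant subspace of `𝔤` on which `dΦ` is irreducible. -/
def IsIrreducible (W : Submodule ℂ 𝔤) : Prop :=
  Φ.IsInvariant W ∧ W ≠ ⊥ ∧ ∀ U : Submodule ℂ 𝔤, Φ.IsInvariant U → U ≤ W → U = ⊥ ∨ U = W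

/-- The structure is short: the representation `dΦ` is a direct sum of irreducible
representations of dimensions 1, 2 and 3. -/
def IsShort : Prop :=
  ∃ (n : ℕ) (W : Fin n → Submodule ℂ 𝔤), DirectSum.IsInternal W ∧
    ∀ i, Φ.IsIrreducible (W i) ∧ Module.finrank ℂ (W i) ∈ ({1, 2, 3} : Set ℕ)

/-- The isotypic component `𝔤₀` of the trivial representation. -/
def g₀ : Submodule ℂ 𝔤 where
  carrier := {x | ∀ X : Sl2, Φ.differential X x = 0}
  add_mem' hx hy X := by rw [map_add, hx X, hy X, add_zero]
  zero_mem' X := map_zero _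
  smul_mem' c x hx X := by rw [map_smul, hx X, smul_zero]

/-- The multiplicity space `J₁ = Hom_{𝔰𝔩₂}(ℂ², 𝔤)` of the tautological representation `ℂ²`.
The isotypic component `𝔤₁ = ℂ² ⊗ J₁` sits in `𝔤` by `u ⊗ a ↦ a u`. -/
def J₁ : Submodule ℂ ((Fin 2 → ℂ) →ₗ[ℂ] 𝔤) where
  carrier := {a | ∀ (X : Sl2) (u : Fin 2 → ℂ),
    Φ.differential X (a u) = a (Matrix.mulVec (X : Matrix (Fin 2) (Fin 2) ℂ) u)}
  add_mem' ha hb X u := by simp only [LinearMap.add_apply, map_add, ha X u, hb X u]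
  zero_mem' X u := by simp
  smul_mem' c a ha X u := by simp only [LinearMap.smul_apply, map_smul, ha X u]

/-- The multiplicity space `J₂ = Hom_{𝔰𝔩₂}(𝔰𝔩₂, 𝔤)` of the adjoint representation.
The isotypic component `𝔤₂ = 𝔰𝔩₂ ⊗ J₂` sits in `𝔤` by `X ⊗ A ↦ A X`. -/
def J₂ : Submodule ℂ (Sl2 →ₗ[ℂ] 𝔤) where
  carrier := {A | ∀ X Y : Sl2, Φ.differential X (A Y) = A ⁅X, Y⁆}
  add_mem' hA hB X Y := by simp only [LinearMap.add_apply, map_add, hA X Y, hB X Y]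
  zero_mem' X Y := by simp
  smul_mem' c A hA X Y := by simp only [LinearMap.smul_apply, map_smul, hA X Y]

/-- The element `u ⊗ a` of `𝔤₁`. -/
def tmul₁ (u : Fin 2 → ℂ) (a : Φ.J₁) : 𝔤 := (a : (Fin 2 → ℂ) →ₗ[ℂ] 𝔤) u

/-- The element `X ⊗ A` of `𝔤₂`. -/
def tmul₂ (X : Sl2) (A : Φ.J₂) : 𝔤 := (A : Sl2 →ₗ[ℂ] 𝔤) X

/-- The operations on multiplicity spaces that the commutator of `𝔤` induces through
`[X ⊗ A, v ⊗ b] = Xv ⊗ Ab` and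
`[X ⊗ A, Y ⊗ B] = [X, Y] ⊗ (A ∘ B) + ½ tr(XY) Δ(A, B)`:
the action `A ↦ (b ↦ Ab)` of `J₂` on `J₁`, the multiplication `A ∘ B` of the Jordan algebra `J₂`,
and the map `Δ : J₂ × J₂ → 𝔤₀`. -/
structure Operations where
  act : Φ.J₂ →ₗ[ℂ] Module.End ℂ Φ.J₁
  mul : Φ.J₂ →ₗ[ℂ] Φ.J₂ →ₗ[ℂ] Φ.J₂
  Delta : Φ.J₂ →ₗ[ℂ] Φ.J₂ →ₗ[ℂ] Φ.g₀
  lie_tmul₂_tmul₁ : ∀ (X : Sl2) (A : Φ.J₂) (v : Fin 2 → ℂ) (b : Φ.J₁),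
    ⁅Φ.tmul₂ X A, Φ.tmul₁ v b⁆ =
      Φ.tmul₁ (Matrix.mulVec (X : Matrix (Fin 2) (Fin 2) ℂ) v) (act A b)
  lie_tmul₂_tmul₂ : ∀ (X Y : Sl2) (A B : Φ.J₂),
    ⁅Φ.tmul₂ X A, Φ.tmul₂ Y B⁆ =
      Φ.tmul₂ ⁅X, Y⁆ (mul A B) +
        (1 / 2 * Matrix.trace ((X : Matrix (Fin 2) (Fin 2) ℂ) * (Y : Matrix (Fin 2) (Fin 2) ℂ))) •
          (Delta A B : 𝔤)

/-- `I` is a unit element of the algebra `J₂`. -/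
def Operations.IsUnitElement {Φ : SL2Structure 𝔤} (O : Φ.Operations) (I : Φ.J₂) : Prop :=
  ∀ A : Φ.J₂, O.mul I A = A ∧ O.mul A I = A

end SL2Structure

/-! Differentiating the identities satisfied by `Φ` shows that `dΦ` is linear, acts by derivations
and respects brackets. For fixed `A` and `b`, the map `X ⊗ v ↦ [X ⊗ A, v ⊗ b]` is then equivariant
from `𝔰𝔩₂ ⊗ ℂ²` to `𝔤`. This source is the sum of irreducibles of dimensions 4 and 2. Shortness
forbids weights `≥ 3` in `𝔤`, so the first summand dies and the map factors through `X ⊗ v ↦ Xv`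
(`exists_J₁_of_equivariant`). Likewise `𝔰𝔩₂ ⊗ 𝔰𝔩₂` has summands of dimensions 5, 3 and 1. The first
dies, and the others are seen by `[X, Y]` and `tr(XY)` (`exists_J₂_g₀_of_equivariant`). Since `[X,
Y]`, `tr(XY)` and `Xv` determine these components, the operations are unique and bilinear.

Since `𝔤` is simple, every derivation is inner and the center is zero. So `dΦ(X) = ad(X ⊗ I)` for
some `I` in `J₂` (`exists_lie_eq_dΦ`). Equivariance of `A` and `a` then says exactly that `I` is a
unit and acts as the identity. -/

/-! ### Weak derivatives, which need no norm on `𝔤`. -/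

/-- A curve `f` in a complex vector space has weak derivative `v` at `0` if each linear functional
of `f` has the corresponding derivative at `0`. -/
def HasWeakDerivAtZero {V : Type*} [AddCommGroup V] [Module ℂ V] (f : ℂ → V) (v : V) : Prop :=
  ∀ ℓ : Module.Dual ℂ V, HasDerivAt (fun t => ℓ (f t)) (ℓ v) 0

namespace HasWeakDerivAtZero

variable {V W U : Type*} [AddCommGroup V] [Module ℂ V] [AddCommGroup W] [Module ℂ W]
  [AddCommGroup U] [Module ℂ U]

theorem unique {f : ℂ → V} {v w : V} (hv : HasWeakDerivAtZero f v)
    (hw : HasWeakDerivAtZero f w) : v = w :=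
  sub_eq_zero.1 <| (Module.forall_dual_apply_eq_zero_iff ℂ _).1 fun ℓ => by
    rw [map_sub, (hv ℓ).unique (hw ℓ), sub_self]

theorem const (v : V) : HasWeakDerivAtZero (fun _ => v) 0 := fun ℓ => by
  simpa using hasDerivAt_const (0 : ℂ) (ℓ v)

theorem map {f : ℂ → V} {v : V} (h : HasWeakDerivAtZero f v) (T : V →ₗ[ℂ] W) :
    HasWeakDerivAtZero (fun t => T (f t)) (T v) := fun ℓ => h (ℓ ∘ₗ T)

/-- In coordinates a bilinear map is a finite sum of products of scalar functions, so the scalar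
product rule suffices. -/
theorem bilin [FiniteDimensional ℂ V] [FiniteDimensional ℂ W] (B : V →ₗ[ℂ] W →ₗ[ℂ] U)
    {f : ℂ → V} {g : ℂ → W} {v : V} {w : W} (hf : HasWeakDerivAtZero f v)
    (hg : HasWeakDerivAtZero g w) :
    HasWeakDerivAtZero (fun t => B (f t) (g t)) (B v (g 0) + B (f 0) w) := by
  intro ℓ
  set b := Module.finBasis ℂ V
  set c := Module.finBasis ℂ W
  have hexp : ∀ x y, ℓ (B x y) = ∑ i, ∑ j, b.coord i x * c.coord j y * ℓ (B (b i) (c j)) := by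
    intro x y
    conv_lhs => rw [← b.sum_repr x, ← c.sum_repr y]
    simp only [map_sum, LinearMap.sum_apply, map_smul, LinearMap.smul_apply, smul_eq_mul,
      Finset.mul_sum, Module.Basis.coord_apply, mul_assoc]
    rw [Finset.sum_comm]
    exact Finset.sum_congr rfl fun i _ => Finset.sum_congr rfl fun j _ => by ring
  have hval : ℓ (B v (g 0) + B (f 0) w) = ∑ i, ∑ j, (b.coord i v * c.coord j (g 0) +
      b.coord i (f 0) * c.coord j w) * ℓ (B (b i) (c j)) := by
    rw [map_add, hexp, hexp]
    simp only [add_mul, Finset.sum_add_distrib]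
  rw [hval, funext fun t => hexp (f t) (g t)]
  exact HasDerivAt.fun_sum fun i _ => HasDerivAt.fun_sum fun j _ =>
    ((hf (b.coord i)).fun_mul (hg (c.coord j))).mul_const _

end HasWeakDerivAtZero

/-! ### One-parameter subgroups and the adjoint action of `SL₂`. -/

theorem oneParam_zero (X : Sl2) : oneParam X 0 = 1 := by
  apply Subtype.ext
  simp [oneParam]

theorem hasWeakDerivAtZero_oneParam (X : Sl2) :
    HasWeakDerivAtZero (fun t => (oneParam X t).1) (X : Matrix (Fin 2) (Fin 2) ℂ) := by
  let _ : NormedRing (Matrix (Fin 2) (Fin 2) ℂ) := Matrix.linftyOpNormedRing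
  let _ : NormedAlgebra ℂ (Matrix (Fin 2) (Fin 2) ℂ) := Matrix.linftyOpNormedAlgebra
  intro ℓ
  have h := hasDerivAt_exp_smul_const (𝕂 := ℂ) (X : Matrix (Fin 2) (Fin 2) ℂ) 0
  have h2 := (LinearMap.toContinuousLinearMap ℓ).hasFDerivAt.comp_hasDerivAt (0 : ℂ) h
  simp at h2
  exact h2

theorem hasDerivAt_oneParam_entry (X : Sl2) (i j : Fin 2) :
    HasDerivAt (fun t => (oneParam X t).1 i j) ((X : Matrix (Fin 2) (Fin 2) ℂ) i j) 0 :=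
  hasWeakDerivAtZero_oneParam X (Matrix.entryLinearMap ℂ ℂ i j)

theorem coe_oneParam (X : Sl2) (t : ℂ) :
    (oneParam X t).1 = NormedSpace.exp (t • (X : Matrix (Fin 2) (Fin 2) ℂ)) := rfl

theorem oneParam_inv (X : Sl2) (t : ℂ) : (oneParam X t)⁻¹ = oneParam (-X) t := by
  rw [inv_eq_iff_mul_eq_one]
  apply Subtype.ext
  rw [Matrix.SpecialLinearGroup.coe_mul, Matrix.SpecialLinearGroup.coe_one, coe_oneParam,
    coe_oneParam, ← Matrix.exp_add_of_commute]
  · simp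
  · simp

/-- The adjoint action of `SL₂` on `𝔰𝔩₂`. -/
def conjSl2 (s : SL2) (Y : Sl2) : Sl2 :=
  ⟨s.1 * (Y : Matrix (Fin 2) (Fin 2) ℂ) * (s⁻¹).1, by
    have hY : (Y : Matrix (Fin 2) (Fin 2) ℂ).trace = 0 := Y.2
    change Matrix.trace (s.1 * (Y : Matrix (Fin 2) (Fin 2) ℂ) * (s⁻¹).1) = 0
    rw [Matrix.trace_mul_comm, ← Matrix.mul_assoc, ← Matrix.SpecialLinearGroup.coe_mul,
      inv_mul_cancel, Matrix.SpecialLinearGroup.coe_one, Matrix.one_mul, hY]⟩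

theorem oneParam_conjSl2 (s : SL2) (Y : Sl2) (t : ℂ) :
    oneParam (conjSl2 s Y) t = s * oneParam Y t * s⁻¹ := by
  apply Subtype.ext
  have hs : s.1 * (s⁻¹).1 = 1 := by
    rw [← Matrix.SpecialLinearGroup.coe_mul, mul_inv_cancel, Matrix.SpecialLinearGroup.coe_one]
  have hinv : (s.1)⁻¹ = (s⁻¹).1 := Matrix.inv_eq_right_inv hs
  have hu : IsUnit s.1 := IsUnit.of_mul_eq_one _ hs
  rw [Matrix.SpecialLinearGroup.coe_mul, Matrix.SpecialLinearGroup.coe_mul, coe_oneParam,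
    coe_oneParam, show (conjSl2 s Y : Matrix (Fin 2) (Fin 2) ℂ) = s.1 * Y * (s⁻¹).1 from rfl,
    ← hinv, ← Matrix.exp_conj _ _ hu, Matrix.mul_smul, Matrix.smul_mul]

/-- `L` is the differential of the polynomial at the identity matrix. Its linearity is the source of
the linearity of `dΦ`. -/
theorem exists_linear_hasDerivAt_eval_oneParam (p : MvPolynomial (Fin 2 × Fin 2) ℂ) :
    ∃ L : Module.Dual ℂ (Matrix (Fin 2) (Fin 2) ℂ), ∀ X : Sl2,
      HasDerivAt (fun t => MvPolynomial.eval (fun ij => (oneParam X t).1 ij.1 ij.2) p) (L X) 0 := by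
  induction p using MvPolynomial.induction_on with
  | C a => exact ⟨0, fun X => by simpa using hasDerivAt_const (0 : ℂ) a⟩
  | add p q hp hq =>
    obtain ⟨L, hL⟩ := hp
    obtain ⟨M, hM⟩ := hq
    exact ⟨L + M, fun X => by simpa only [map_add, LinearMap.add_apply] using (hL X).fun_add (hM X)⟩
  | mul_X p ij hp =>
    obtain ⟨L, hL⟩ := hp
    refine ⟨(1 : Matrix (Fin 2) (Fin 2) ℂ) ij.1 ij.2 • L +
      MvPolynomial.eval (fun ij => (1 : Matrix (Fin 2) (Fin 2) ℂ) ij.1 ij.2) p •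
        Matrix.entryLinearMap ℂ ℂ ij.1 ij.2, fun X => ?_⟩
    simp only [map_mul, MvPolynomial.eval_X]
    have h := (hL X).fun_mul (hasDerivAt_oneParam_entry X ij.1 ij.2)
    rw [oneParam_zero] at h
    refine h.congr_deriv ?_
    rw [LinearMap.add_apply, LinearMap.smul_apply, LinearMap.smul_apply, smul_eq_mul, smul_eq_mul,
      mul_comm (L X)]
    rfl

/-! ### The differential as a representation by derivations. -/

namespace SL2Structure

theorem toAut_one {𝔤 : Type*} [LieRing 𝔤] [LieAlgebra ℂ 𝔤] (Φ : SL2Structure 𝔤) (x : 𝔤) :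
    Φ.toAut 1 x = x := by
  apply (Φ.toAut 1).injective
  exact (Φ.toAut_mul 1 1 x).symm.trans (by rw [one_mul]; rfl)

variable {𝔤 : Type*} [LieRing 𝔤] [LieAlgebra ℂ 𝔤] [FiniteDimensional ℂ 𝔤] (Φ : SL2Structure 𝔤)

theorem hasWeakDerivAtZero_toAut (X : Sl2) (x : 𝔤) :
    HasWeakDerivAtZero (fun t => Φ.toAut (oneParam X t) x) (Φ.differential X x) :=
  fun ℓ => Φ.hasDerivAt_differential X x ℓ

theorem exists_dual_differential (ℓ : Module.Dual ℂ 𝔤) (x : 𝔤) :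
    ∃ L : Module.Dual ℂ (Matrix (Fin 2) (Fin 2) ℂ), ∀ X : Sl2, ℓ (Φ.differential X x) = L X := by
  obtain ⟨p, hp⟩ := Φ.algebraic ℓ x
  obtain ⟨L, hL⟩ := exists_linear_hasDerivAt_eval_oneParam p
  refine ⟨L, fun X => (Φ.hasDerivAt_differential X x ℓ).unique ?_⟩
  simpa only [hp] using hL X

/-- The differential as a linear map. -/
noncomputable def dΦ : Sl2 →ₗ[ℂ] Module.End ℂ 𝔤 where
  toFun := Φ.differential
  map_add' X Y := by
    ext x
    refine sub_eq_zero.1 <| (Module.forall_dual_apply_eq_zero_iff ℂ _).1 fun ℓ => ?_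
    obtain ⟨L, hL⟩ := Φ.exists_dual_differential ℓ x
    simp [hL]
  map_smul' c X := by
    ext x
    refine sub_eq_zero.1 <| (Module.forall_dual_apply_eq_zero_iff ℂ _).1 fun ℓ => ?_
    obtain ⟨L, hL⟩ := Φ.exists_dual_differential ℓ x
    simp [hL]

theorem dΦ_apply (X : Sl2) : Φ.dΦ X = Φ.differential X := rfl

theorem dΦ_leibniz (X : Sl2) (x y : 𝔤) :
    Φ.dΦ X ⁅x, y⁆ = ⁅Φ.dΦ X x, y⁆ + ⁅x, Φ.dΦ X y⁆ := by
  have h := (Φ.hasWeakDerivAtZero_toAut X x).bilin (LieModule.toEnd ℂ 𝔤 𝔤).toLinearMap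
    (Φ.hasWeakDerivAtZero_toAut X y)
  have h' := Φ.hasWeakDerivAtZero_toAut X ⁅x, y⁆
  have hlie : ∀ s, Φ.toAut s ⁅x, y⁆ = ⁅Φ.toAut s x, Φ.toAut s y⁆ := fun s =>
    LieEquiv.map_lie (Φ.toAut s) x y
  simp only [hlie] at h'
  rw [dΦ_apply, h'.unique h]
  simp [oneParam_zero, toAut_one]

/-- Differentiate `Φ(s exp(tY) s⁻¹) Φ(s) = Φ(s) Φ(exp tY)` in `t`. -/
theorem dΦ_conjSl2 (s : SL2) (Y : Sl2) (x : 𝔤) :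
    Φ.dΦ (conjSl2 s Y) (Φ.toAut s x) = Φ.toAut s (Φ.dΦ Y x) := by
  refine (Φ.hasWeakDerivAtZero_toAut (conjSl2 s Y) (Φ.toAut s x)).unique ?_
  convert (Φ.hasWeakDerivAtZero_toAut Y x).map ((Φ.toAut s).toLinearEquiv : 𝔤 →ₗ[ℂ] 𝔤) using 2
    with t
  · rw [oneParam_conjSl2, ← Φ.toAut_mul, mul_assoc, inv_mul_cancel, mul_one, Φ.toAut_mul]
    rfl
  · rfl

/-- Differentiate `Φ(s) dΦ(Y) = dΦ(s Y s⁻¹) Φ(s)` along `s = exp(tX)`. -/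
theorem dΦ_lie (X Y : Sl2) (x : 𝔤) :
    Φ.dΦ ⁅X, Y⁆ x = Φ.dΦ X (Φ.dΦ Y x) - Φ.dΦ Y (Φ.dΦ X x) := by
  -- Extending `dΦ` to all matrices lets the product rule treat the factors of `s Y s⁻¹` separately,
  -- as they are not traceless.
  obtain ⟨D, hD⟩ := LinearMap.exists_extend (p := Sl2.toSubmodule) Φ.dΦ
  have hD' : ∀ Z : Sl2, Φ.dΦ Z = D Z := fun Z => (LinearMap.congr_fun hD Z).symm
  have h1 := ((hasWeakDerivAtZero_oneParam X).bilin (LinearMap.mul ℂ _)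
    (HasWeakDerivAtZero.const (Y : Matrix (Fin 2) (Fin 2) ℂ))).bilin (LinearMap.mul ℂ _)
    (hasWeakDerivAtZero_oneParam (-X))
  have h2 := h1.bilin D (Φ.hasWeakDerivAtZero_toAut X x)
  have h3 := Φ.hasWeakDerivAtZero_toAut X (Φ.dΦ Y x)
  have h4 : ∀ t, Φ.toAut (oneParam X t) (Φ.dΦ Y x) =
      D ((oneParam X t).1 * (Y : Matrix (Fin 2) (Fin 2) ℂ) * (oneParam (-X) t).1)
        (Φ.toAut (oneParam X t) x) := fun t => by
    rw [← Φ.dΦ_conjSl2, hD', ← oneParam_inv]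
    rfl
  simp only [h4] at h3
  have h5 := h3.unique h2
  simp only [oneParam_zero, LinearMap.mul_apply', map_zero, add_zero, toAut_one,
    Matrix.SpecialLinearGroup.coe_one, one_mul, mul_one] at h5
  rw [dΦ_apply Φ X, h5, ← dΦ_apply, ← hD', add_sub_cancel_right, hD']
  congr 2
  simp [Ring.lie_def, sub_eq_add_neg]

end SL2Structure

/-! ### Nilpotency of raising operators. -/

/-- Otherwise every power `E ^ k` would be an eigenvector of `ad H` with eigenvalue `2k`, giving
infinitely many eigenvalues in finite dimension. -/
theorem isNilpotent_of_lie_eq_two_smul {V : Type*} [AddCommGroup V] [Module ℂ V]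
    [FiniteDimensional ℂ V] {H E : Module.End ℂ V} (h : H * E = E * H + (2 : ℂ) • E) :
    IsNilpotent E := by
  by_contra hE
  let T : Module.End ℂ (Module.End ℂ V) := LinearMap.mulLeft ℂ H - LinearMap.mulRight ℂ H
  have hT : ∀ k : ℕ, H * E ^ k = E ^ k * H + (2 * k : ℂ) • E ^ k := by
    intro k
    induction k with
    | zero => simp
    | succ k ih =>
      rw [pow_succ, ← mul_assoc, ih, add_mul, mul_assoc, h, mul_add, ← mul_assoc, smul_mul_assoc,
        mul_smul_comm, add_assoc, ← add_smul]
      push_cast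
      ring_nf
  have hev : ∀ k : ℕ, T.HasEigenvalue (2 * k : ℂ) := fun k =>
    Module.End.hasEigenvalue_of_hasEigenvector (x := E ^ k)
      ⟨Module.End.mem_eigenspace_iff.2 (by simp [T, hT k]), fun h0 => hE ⟨k, h0⟩⟩
  refine Set.infinite_of_injective_forall_mem (f := fun k : ℕ => (2 * k : ℂ)) ?_ hev
    T.finite_hasEigenvalue
  intro a b hab
  simpa using hab

/-! ### The standard basis of `𝔰𝔩₂`. -/

namespace Sl2

theorem coe_one_one (X : Sl2) :
    (X : Matrix (Fin 2) (Fin 2) ℂ) 1 1 = -(X : Matrix (Fin 2) (Fin 2) ℂ) 0 0 := by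
  have hX : (X : Matrix (Fin 2) (Fin 2) ℂ).trace = 0 := X.2
  rw [Matrix.trace_fin_two] at hX
  linear_combination hX

theorem mem_of_trace_eq_zero {X : Matrix (Fin 2) (Fin 2) ℂ} (hX : X.trace = 0) : X ∈ Sl2 := hX

/-- The raising element of the standard basis. -/
def e : Sl2 := ⟨!![0, 1; 0, 0], mem_of_trace_eq_zero (by simp [Matrix.trace_fin_two])⟩

/-- The semisimple element of the standard basis. -/
def h : Sl2 := ⟨!![1, 0; 0, -1], mem_of_trace_eq_zero (by simp [Matrix.trace_fin_two])⟩

/-- The lowering element of the standard basis. -/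
def f : Sl2 := ⟨!![0, 0; 1, 0], mem_of_trace_eq_zero (by simp [Matrix.trace_fin_two])⟩

theorem eq_combination (X : Sl2) :
    X = (X : Matrix (Fin 2) (Fin 2) ℂ) 0 0 • h + (X : Matrix (Fin 2) (Fin 2) ℂ) 0 1 • e +
      (X : Matrix (Fin 2) (Fin 2) ℂ) 1 0 • f := by
  apply Subtype.ext
  ext i j
  fin_cases i <;> fin_cases j <;> simp [h, e, f, coe_one_one X]

theorem lie_h_e : ⁅h, e⁆ = (2 : ℂ) • e := by
  apply Subtype.ext
  ext i j
  fin_cases i <;> fin_cases j <;> simp [h, e, Ring.lie_def]; norm_num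

theorem lie_h_f : ⁅h, f⁆ = -(2 : ℂ) • f := by
  apply Subtype.ext
  ext i j
  fin_cases i <;> fin_cases j <;> simp [h, f, Ring.lie_def]; norm_num

theorem lie_e_f : ⁅e, f⁆ = h := by
  apply Subtype.ext
  ext i j
  fin_cases i <;> fin_cases j <;> simp [h, e, f, Ring.lie_def]

theorem lie_e_h : ⁅e, h⁆ = -(2 : ℂ) • e := by rw [← lie_skew, lie_h_e, neg_smul]

theorem lie_f_h : ⁅f, h⁆ = (2 : ℂ) • f := by rw [← lie_skew, lie_h_f, neg_smul, neg_neg]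

theorem lie_f_e : ⁅f, e⁆ = -h := by rw [← lie_skew, lie_e_f]

theorem coe_h : (h : Matrix (Fin 2) (Fin 2) ℂ) = !![1, 0; 0, -1] := rfl

theorem coe_f : (f : Matrix (Fin 2) (Fin 2) ℂ) = !![0, 0; 1, 0] := rfl

theorem coe_lie (X Y : Sl2) : ((⁅X, Y⁆ : Sl2) : Matrix (Fin 2) (Fin 2) ℂ) =
    (X : Matrix (Fin 2) (Fin 2) ℂ) * Y - Y * X := rfl

end Sl2

/-! ### Weights of a short structure. -/

namespace SL2Structure

variable {𝔤 : Type*} [LieRing 𝔤] [LieAlgebra ℂ 𝔤] [FiniteDimensional ℂ 𝔤] (Φ : SL2Structure 𝔤)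

open Sl2

theorem isNilpotent_dΦ_of_lie {X Y : Sl2} (h : ⁅X, Y⁆ = (2 : ℂ) • Y) : IsNilpotent (Φ.dΦ Y) := by
  refine isNilpotent_of_lie_eq_two_smul (H := Φ.dΦ X) ?_
  ext x
  have := Φ.dΦ_lie X Y x
  rw [h, map_smul] at this
  simp only [Module.End.mul_apply, LinearMap.add_apply, this]
  abel

variable {Φ}

theorem dΦ_pow_three_apply {Y : Sl2} (h : Φ.dΦ Y ^ 3 = 0) (x : 𝔤) :
    Φ.dΦ Y (Φ.dΦ Y (Φ.dΦ Y x)) = 0 := by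
  have := LinearMap.congr_fun h x
  rwa [pow_succ, pow_two, Module.End.mul_apply, Module.End.mul_apply] at this

/-- On a summand of dimension `d ≤ 3` a nilpotent operator has characteristic polynomial `X ^ d`, so
Cayley–Hamilton applies. -/
theorem IsShort.pow_three_eq_zero (hΦ : Φ.IsShort) {Y : Sl2} (hY : IsNilpotent (Φ.dΦ Y)) :
    Φ.dΦ Y ^ 3 = 0 := by
  obtain ⟨n, W, hW, hirr⟩ := hΦ
  have hker : ∀ i, W i ≤ LinearMap.ker (Φ.dΦ Y ^ 3) := by
    intro i x hx
    have hinv : ∀ x ∈ W i, Φ.dΦ Y x ∈ W i := (hirr i).1.1 Y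
    have hnil : IsNilpotent ((Φ.dΦ Y).restrict hinv) := by
      obtain ⟨k, hk⟩ := hY
      refine ⟨k, ?_⟩
      rw [Module.End.pow_restrict k]
      ext x
      simp [hk]
    have hcp := LinearMap.aeval_self_charpoly ((Φ.dΦ Y).restrict hinv)
    rw [(LinearMap.charpoly_eq_X_pow_iff _).2 (fun m => by
      obtain ⟨k, hk⟩ := hnil
      exact ⟨k, by rw [hk]; rfl⟩), map_pow, Polynomial.aeval_X] at hcp
    have hle : Module.finrank ℂ (W i) ≤ 3 := by
      have := (hirr i).2
      simp only [Set.mem_insert_iff, Set.mem_singleton_iff] at this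
      omega
    have h3 : (Φ.dΦ Y).restrict hinv ^ 3 = 0 := pow_eq_zero_of_le hle hcp
    rw [Module.End.pow_restrict] at h3
    have := congrArg Subtype.val (LinearMap.congr_fun h3 ⟨x, hx⟩)
    simpa using this
  have htop : LinearMap.ker (Φ.dΦ Y ^ 3) = ⊤ := by
    rw [eq_top_iff, ← hW.submodule_iSup_eq_top]
    exact iSup_le hker
  exact LinearMap.ker_eq_top.1 htop

variable (Φ) in
theorem dΦ_e_dΦ_f (x : 𝔤) : Φ.dΦ e (Φ.dΦ f x) = Φ.dΦ f (Φ.dΦ e x) + Φ.dΦ h x := by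
  rw [← lie_e_f, Φ.dΦ_lie]
  abel

variable (Φ) in
theorem dΦ_h_dΦ_e (x : 𝔤) : Φ.dΦ h (Φ.dΦ e x) = Φ.dΦ e (Φ.dΦ h x) + (2 : ℂ) • Φ.dΦ e x := by
  have := Φ.dΦ_lie h e x
  rw [lie_h_e, map_smul, LinearMap.smul_apply] at this
  rw [this]
  abel

variable (Φ) in
theorem dΦ_h_dΦ_f (x : 𝔤) : Φ.dΦ h (Φ.dΦ f x) = Φ.dΦ f (Φ.dΦ h x) - (2 : ℂ) • Φ.dΦ f x := by
  have := Φ.dΦ_lie h f x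
  rw [lie_h_f, map_smul, LinearMap.smul_apply, neg_smul] at this
  rw [sub_eq_add_neg, this, add_sub_cancel]

/-- For a primitive vector, `e³f³x = 6μ(μ - 1)(μ - 2)x`, while `f³ = 0`. -/
theorem IsShort.primitive_eq_zero (hΦ : Φ.IsShort) {x : 𝔤} {μ : ℂ} (hh : Φ.dΦ h x = μ • x)
    (he : Φ.dΦ e x = 0) (hμ : μ * (μ - 1) * (μ - 2) ≠ 0) : x = 0 := by
  have hF : Φ.dΦ f (Φ.dΦ f (Φ.dΦ f x)) = 0 :=
    dΦ_pow_three_apply (hΦ.pow_three_eq_zero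
      (Φ.isNilpotent_dΦ_of_lie (X := -h) (by rw [neg_lie, lie_h_f, neg_smul, neg_neg]))) x
  have h1 : Φ.dΦ h (Φ.dΦ f x) = (μ - 2) • Φ.dΦ f x := by
    rw [dΦ_h_dΦ_f, hh, map_smul, sub_smul]
  have h2 : Φ.dΦ h (Φ.dΦ f (Φ.dΦ f x)) = (μ - 4) • Φ.dΦ f (Φ.dΦ f x) := by
    rw [dΦ_h_dΦ_f, h1, map_smul, ← sub_smul]
    ring_nf
  have e1 : Φ.dΦ e (Φ.dΦ f x) = μ • x := by rw [dΦ_e_dΦ_f, he, map_zero, zero_add, hh]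
  have e2 : Φ.dΦ e (Φ.dΦ f (Φ.dΦ f x)) = (2 * (μ - 1)) • Φ.dΦ f x := by
    rw [dΦ_e_dΦ_f, e1, h1, map_smul, ← add_smul]
    ring_nf
  have e3 : Φ.dΦ e (Φ.dΦ f (Φ.dΦ f (Φ.dΦ f x))) = (3 * (μ - 2)) • Φ.dΦ f (Φ.dΦ f x) := by
    rw [dΦ_e_dΦ_f, e2, h2, map_smul, ← add_smul]
    ring_nf
  have key : (6 * (μ * (μ - 1) * (μ - 2))) • x = 0 := by
    have := congrArg (fun y => Φ.dΦ e (Φ.dΦ e (Φ.dΦ e y))) hF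
    simp only [e3, e2, e1, map_smul, map_zero, smul_smul] at this
    rw [← this]
    ring_nf
  exact (smul_eq_zero.1 key).resolve_left (mul_ne_zero (by norm_num) hμ)

/-- Since `e³ = 0`, the vector `e²x` is primitive of weight `m + 4`, hence zero. Then `ex` and
finally `x` are primitive, and vanish for the same reason. -/
theorem IsShort.eigenvector_eq_zero (hΦ : Φ.IsShort) {x : 𝔤} (m : ℕ) (hm : 3 ≤ m)
    (hh : Φ.dΦ h x = (m : ℂ) • x) : x = 0 := by
  have hne : ∀ k : ℕ, 3 ≤ k → (k : ℂ) * (k - 1) * (k - 2) ≠ 0 := by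
    intro k hk
    obtain ⟨j, rfl⟩ := Nat.exists_eq_add_of_le hk
    have h1 : ((j + 3 : ℕ) : ℂ) * ((j + 2 : ℕ) : ℂ) * ((j + 1 : ℕ) : ℂ) ≠ 0 :=
      mul_ne_zero (mul_ne_zero (Nat.cast_ne_zero.2 (by omega)) (Nat.cast_ne_zero.2 (by omega)))
        (Nat.cast_ne_zero.2 (by omega))
    convert h1 using 1
    push_cast
    ring
  have hE : Φ.dΦ e (Φ.dΦ e (Φ.dΦ e x)) = 0 :=
    dΦ_pow_three_apply (hΦ.pow_three_eq_zero (Φ.isNilpotent_dΦ_of_lie lie_h_e)) x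
  have h1 : Φ.dΦ h (Φ.dΦ e x) = ((m + 2 : ℕ) : ℂ) • Φ.dΦ e x := by
    rw [dΦ_h_dΦ_e, hh, map_smul, ← add_smul]
    push_cast
    rfl
  have h2 : Φ.dΦ h (Φ.dΦ e (Φ.dΦ e x)) = ((m + 4 : ℕ) : ℂ) • Φ.dΦ e (Φ.dΦ e x) := by
    rw [dΦ_h_dΦ_e, h1, map_smul, ← add_smul]
    push_cast
    ring_nf
  have z2 := hΦ.primitive_eq_zero h2 hE (hne _ (by omega))
  have z1 := hΦ.primitive_eq_zero h1 z2 (hne _ (by omega))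
  exact hΦ.primitive_eq_zero hh z1 (hne _ hm)

end SL2Structure

/-! ### Equivariant maps from `𝔰𝔩₂ ⊗ ℂ²` and `𝔰𝔩₂ ⊗ 𝔰𝔩₂`. -/

namespace SL2Structure

variable {𝔤 : Type*} [LieRing 𝔤] [LieAlgebra ℂ 𝔤] [FiniteDimensional ℂ 𝔤] {Φ : SL2Structure 𝔤}

open Sl2

/-- Already `h` is invertible on `ℂ²`, so the vectors `Xv` exhaust it. -/
theorem tmul₁_ext {c c' : Φ.J₁} (hc : ∀ (X : Sl2) (v : Fin 2 → ℂ),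
    Φ.tmul₁ (Matrix.mulVec (X : Matrix (Fin 2) (Fin 2) ℂ) v) c =
      Φ.tmul₁ (Matrix.mulVec (X : Matrix (Fin 2) (Fin 2) ℂ) v) c') : c = c' := by
  apply Subtype.ext
  apply LinearMap.ext
  intro v
  have hv : Matrix.mulVec (h : Matrix (Fin 2) (Fin 2) ℂ) ![v 0, -v 1] = v := by
    ext i
    fin_cases i <;> simp [coe_h, Matrix.mulVec, dotProduct, Fin.sum_univ_two]
  have := hc h ![v 0, -v 1]
  rwa [hv] at this

theorem exists_eq_lie (X : Sl2) : ∃ Y Z Y' Z' : Sl2, X = ⁅Y, Z⁆ + ⁅Y', Z'⁆ := by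
  refine ⟨h, ((X : Matrix (Fin 2) (Fin 2) ℂ) 0 1 / 2) • e -
    ((X : Matrix (Fin 2) (Fin 2) ℂ) 1 0 / 2) • f, (X : Matrix (Fin 2) (Fin 2) ℂ) 0 0 • e, f, ?_⟩
  conv_lhs => rw [eq_combination X]
  rw [lie_sub, lie_smul, lie_smul, smul_lie, lie_h_e, lie_h_f, lie_e_f]
  module

/-- The part antisymmetric in `X, Y` determines `C`, because brackets span `𝔰𝔩₂`. Setting `X = Y =
h` isolates `δ`, because `tr(h²) = 2`. -/
theorem tmul₂_add_smul_ext {C C' : Φ.J₂} {δ δ' : Φ.g₀} (hc : ∀ X Y : Sl2,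
    Φ.tmul₂ ⁅X, Y⁆ C + (1 / 2 * Matrix.trace ((X : Matrix (Fin 2) (Fin 2) ℂ) *
      (Y : Matrix (Fin 2) (Fin 2) ℂ))) • (δ : 𝔤) =
    Φ.tmul₂ ⁅X, Y⁆ C' + (1 / 2 * Matrix.trace ((X : Matrix (Fin 2) (Fin 2) ℂ) *
      (Y : Matrix (Fin 2) (Fin 2) ℂ))) • (δ' : 𝔤)) : C = C' ∧ δ = δ' := by
  constructor
  · have hlie : ∀ X Y : Sl2, C.1 ⁅X, Y⁆ = C'.1 ⁅X, Y⁆ := by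
      intro X Y
      have h1 := hc X Y
      have h2 := hc Y X
      rw [Matrix.trace_mul_comm] at h2
      simp only [tmul₂, ← lie_skew X Y, map_neg] at h1 h2 ⊢
      have h3 : (2 : ℂ) • C.1 ⁅Y, X⁆ = (2 : ℂ) • C'.1 ⁅Y, X⁆ := by
        linear_combination (norm := module) h2 - h1
      rw [smul_right_injective 𝔤 (two_ne_zero' ℂ) h3]
    apply Subtype.ext
    apply LinearMap.ext
    intro X
    obtain ⟨Y, Z, Y', Z', rfl⟩ := exists_eq_lie X
    rw [map_add, map_add, hlie, hlie]
  · have h1 := hc h h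
    simp only [tmul₂, lie_self, map_zero, zero_add] at h1
    have htr :
        Matrix.trace ((h : Matrix (Fin 2) (Fin 2) ℂ) * (h : Matrix (Fin 2) (Fin 2) ℂ)) = 2 := by
      simp [coe_h, Matrix.trace_fin_two]
      norm_num
    rw [htr] at h1
    apply Subtype.ext
    simpa using h1

/-- The vector `e ⊗ p` has weight 3, so `T` kills it. Applying `f` three times gives the remaining
relations `r1`, `r2`, `r4`, which span the kernel of `X ⊗ v ↦ Xv`. -/
theorem exists_J₁_of_equivariant (hΦ : Φ.IsShort) (T : Sl2 →ₗ[ℂ] (Fin 2 → ℂ) →ₗ[ℂ] 𝔤)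
    (hT : ∀ (Z X : Sl2) (v : Fin 2 → ℂ), Φ.dΦ Z (T X v) =
      T ⁅Z, X⁆ v + T X (Matrix.mulVec (Z : Matrix (Fin 2) (Fin 2) ℂ) v)) :
    ∃ c : Φ.J₁, ∀ (X : Sl2) (v : Fin 2 → ℂ),
      T X v = Φ.tmul₁ (Matrix.mulVec (X : Matrix (Fin 2) (Fin 2) ℂ) v) c := by
  set p : Fin 2 → ℂ := ![1, 0] with hp
  set q : Fin 2 → ℂ := ![0, 1] with hq
  have hv : ∀ v : Fin 2 → ℂ, v = v 0 • p + v 1 • q := by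
    intro v
    ext i
    fin_cases i <;> simp [hp, hq]
  have hhp : Matrix.mulVec (h : Matrix (Fin 2) (Fin 2) ℂ) p = p := by
    ext i
    fin_cases i <;> simp [coe_h, hp, Matrix.mulVec, dotProduct, Fin.sum_univ_two]
  have hfp : Matrix.mulVec (f : Matrix (Fin 2) (Fin 2) ℂ) p = q := by
    ext i
    fin_cases i <;> simp [coe_f, hp, hq, Matrix.mulVec, dotProduct, Fin.sum_univ_two]
  have hfq : Matrix.mulVec (f : Matrix (Fin 2) (Fin 2) ℂ) q = 0 := by
    ext i
    fin_cases i <;> simp [coe_f, hq, Matrix.mulVec, dotProduct, Fin.sum_univ_two]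
  have r3 : T e p = 0 := by
    refine hΦ.eigenvector_eq_zero 3 le_rfl ?_
    rw [hT, lie_h_e, hhp, map_smul, LinearMap.smul_apply]
    push_cast
    module
  have r1 : T e q = T h p := by
    have := hT f e p
    rw [r3, map_zero, lie_f_e, hfp, map_neg, LinearMap.neg_apply] at this
    linear_combination (norm := module) -this
  have r2 : T f p = -T h q := by
    have := hT f h p
    rw [← r1, hT, lie_f_e, lie_f_h, hfp, hfq, map_zero, map_neg, map_smul, LinearMap.smul_apply,
      LinearMap.neg_apply] at this
    refine smul_right_injective 𝔤 (two_ne_zero' ℂ) ?_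
    linear_combination (norm := module) -this
  have r4 : T f q = 0 := by
    have := hT f f p
    rw [r2, map_neg, hT, lie_f_h, lie_self, hfp, hfq, map_zero, map_zero, map_smul,
      LinearMap.smul_apply, LinearMap.zero_apply] at this
    refine (smul_eq_zero.1 (?_ : (3 : ℂ) • T f q = 0)).resolve_left (by norm_num)
    linear_combination (norm := module) -this
  -- The values on `p` and `q` are forced by `hp = p` and `fp = q`.
  let c : (Fin 2 → ℂ) →ₗ[ℂ] 𝔤 :=
    (LinearMap.proj 0 : (Fin 2 → ℂ) →ₗ[ℂ] ℂ).smulRight (T h p) +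
      (LinearMap.proj 1 : (Fin 2 → ℂ) →ₗ[ℂ] ℂ).smulRight (T f p)
  have hc : ∀ (X : Sl2) (v : Fin 2 → ℂ),
      T X v = c (Matrix.mulVec (X : Matrix (Fin 2) (Fin 2) ℂ) v) := by
    intro X v
    have h1 : T X v = T ((X : Matrix (Fin 2) (Fin 2) ℂ) 0 0 • h +
        (X : Matrix (Fin 2) (Fin 2) ℂ) 0 1 • e + (X : Matrix (Fin 2) (Fin 2) ℂ) 1 0 • f)
        (v 0 • p + v 1 • q) := by rw [← eq_combination, ← hv]
    have h2 : T h q = -T f p := by rw [r2, neg_neg]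
    rw [h1]
    simp only [c, map_add, map_smul, LinearMap.add_apply, LinearMap.smul_apply, r1, r3, r4, h2,
      LinearMap.smulRight_apply, LinearMap.proj_apply, Matrix.mulVec, dotProduct,
      Fin.sum_univ_two, coe_one_one X]
    module
  refine ⟨⟨c, fun Z u => ?_⟩, hc⟩
  -- Every `u` has the form `hw`, and equivariance of `c` follows from `[Z, h]w + hZw = Zhw`.
  have hu : Matrix.mulVec (h : Matrix (Fin 2) (Fin 2) ℂ) ![u 0, -u 1] = u := by
    ext i
    fin_cases i <;> simp [coe_h, Matrix.mulVec, dotProduct, Fin.sum_univ_two]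
  rw [← hu, ← hc, ← dΦ_apply, hT, hc, hc, ← map_add, coe_lie, Matrix.sub_mulVec,
    Matrix.mulVec_mulVec, Matrix.mulVec_mulVec, sub_add_cancel]

/-- The vector `e ⊗ e` has weight 4, so `T` kills it. Lowering it four times by `f` yields `rhe`,
`rhh`, `rhf`, `rff`, and `T` is determined by its antisymmetric part and `T h h`. -/
theorem exists_J₂_g₀_of_equivariant (hΦ : Φ.IsShort) (T : Sl2 →ₗ[ℂ] Sl2 →ₗ[ℂ] 𝔤)
    (hT : ∀ Z X Y : Sl2, Φ.dΦ Z (T X Y) = T ⁅Z, X⁆ Y + T X ⁅Z, Y⁆) :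
    ∃ (C : Φ.J₂) (δ : Φ.g₀), ∀ X Y : Sl2, T X Y = Φ.tmul₂ ⁅X, Y⁆ C +
      (1 / 2 * Matrix.trace ((X : Matrix (Fin 2) (Fin 2) ℂ) *
        (Y : Matrix (Fin 2) (Fin 2) ℂ))) • (δ : 𝔤) := by
  have cancel : ∀ {x y : 𝔤}, (2 : ℂ) • x = (2 : ℂ) • y → x = y := fun hxy =>
    smul_right_injective 𝔤 (two_ne_zero' ℂ) hxy
  have ree : T e e = 0 := by
    refine hΦ.eigenvector_eq_zero 4 (by norm_num) ?_
    rw [hT, lie_h_e, map_smul, map_smul, LinearMap.smul_apply]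
    push_cast
    module
  have rhe : T h e = -T e h := by
    have := hT f e e
    rw [ree, map_zero, lie_f_e, map_neg, map_neg, LinearMap.neg_apply] at this
    linear_combination (norm := module) this
  have rhh : T h h = T e f + T f e := by
    have := hT f h e
    rw [rhe, map_neg, hT, lie_f_e, lie_f_h, map_neg, map_smul, map_smul, LinearMap.smul_apply,
      map_neg, LinearMap.neg_apply] at this
    apply cancel
    linear_combination (norm := module) this
  have rhf : T h f = -T f h := by
    have := hT f h h
    rw [rhh, map_add, hT, hT, lie_f_e, lie_f_h, lie_self, map_zero, map_zero, map_neg, map_smul,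
      map_smul, LinearMap.smul_apply, map_neg, LinearMap.neg_apply, LinearMap.zero_apply] at this
    refine (smul_right_injective 𝔤 (three_ne_zero' ℂ)) ?_
    linear_combination (norm := module) -this
  have rff : T f f = 0 := by
    have := hT f h f
    rw [rhf, map_neg, hT, lie_f_h, lie_self, map_zero, map_smul, map_smul, LinearMap.smul_apply,
      LinearMap.zero_apply, map_zero] at this
    refine (smul_eq_zero.1 (?_ : (4 : ℂ) • T f f = 0)).resolve_left (by norm_num)
    linear_combination (norm := module) -this
  -- The coefficients come from halving the antisymmetric part of `T` and using `[e, f] = h`, `[h,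
  -- e] = 2e`, `[h, f] = -2f`.
  let C : Sl2 →ₗ[ℂ] 𝔤 :=
    { toFun := fun X => ((1 / 2 : ℂ) * (X : Matrix (Fin 2) (Fin 2) ℂ) 0 0) • (T e f - T f e) +
        ((1 / 2 : ℂ) * (X : Matrix (Fin 2) (Fin 2) ℂ) 0 1) • T h e -
        ((1 / 2 : ℂ) * (X : Matrix (Fin 2) (Fin 2) ℂ) 1 0) • T h f
      map_add' := fun X Y => by
        change ((1 / 2 : ℂ) * (X.1 0 0 + Y.1 0 0)) • (T e f - T f e) +
          ((1 / 2 : ℂ) * (X.1 0 1 + Y.1 0 1)) • T h e -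
          ((1 / 2 : ℂ) * (X.1 1 0 + Y.1 1 0)) • T h f = _
        module
      map_smul' := fun a X => by
        change ((1 / 2 : ℂ) * (a * X.1 0 0)) • (T e f - T f e) +
          ((1 / 2 : ℂ) * (a * X.1 0 1)) • T h e - ((1 / 2 : ℂ) * (a * X.1 1 0)) • T h f = a • _
        module }
  have hδ : ∀ Z : Sl2, Φ.differential Z (T h h) = 0 := by
    intro Z
    rw [← dΦ_apply, hT, eq_combination Z]
    simp only [add_lie, smul_lie, lie_self, lie_e_h, lie_f_h, map_add, map_smul,
      LinearMap.add_apply, LinearMap.smul_apply, rhe, rhf, smul_zero, map_zero,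
      LinearMap.zero_apply]
    module
  have hC : ∀ X Y : Sl2, T X Y = C ⁅X, Y⁆ + (1 / 2 * Matrix.trace
      ((X : Matrix (Fin 2) (Fin 2) ℂ) * (Y : Matrix (Fin 2) (Fin 2) ℂ))) • T h h := by
    intro X Y
    have h1 : T X Y = T ((X : Matrix (Fin 2) (Fin 2) ℂ) 0 0 • h +
        (X : Matrix (Fin 2) (Fin 2) ℂ) 0 1 • e + (X : Matrix (Fin 2) (Fin 2) ℂ) 1 0 • f)
        ((Y : Matrix (Fin 2) (Fin 2) ℂ) 0 0 • h +
        (Y : Matrix (Fin 2) (Fin 2) ℂ) 0 1 • e + (Y : Matrix (Fin 2) (Fin 2) ℂ) 1 0 • f) := by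
      rw [← eq_combination, ← eq_combination]
    rw [h1]
    simp only [C, map_add, map_smul, LinearMap.add_apply, LinearMap.smul_apply, ree, rhe, rhh, rhf,
      rff, LinearMap.coe_mk, AddHom.coe_mk, coe_lie, Matrix.sub_apply, Matrix.mul_apply,
      Fin.sum_univ_two, Matrix.trace_fin_two, coe_one_one X, coe_one_one Y]
    module
  refine ⟨⟨C, fun Z W => ?_⟩, ⟨T h h, hδ⟩, hC⟩
  -- The trace term is symmetric and drops out, so `C` inherits equivariance from `T` on brackets,
  -- which span `𝔰𝔩₂`.
  have hanti : ∀ X Y : Sl2, (2 : ℂ) • C ⁅X, Y⁆ = T X Y - T Y X := by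
    intro X Y
    rw [hC X Y, hC Y X, Matrix.trace_mul_comm, ← lie_skew X Y, map_neg]
    module
  have hlie : ∀ X Y : Sl2, Φ.differential Z (C ⁅X, Y⁆) = C ⁅Z, ⁅X, Y⁆⁆ := by
    intro X Y
    apply cancel
    rw [← map_smul, hanti, ← dΦ_apply, map_sub, hT, hT, leibniz_lie, map_add, smul_add, hanti,
      hanti]
    abel
  obtain ⟨X, Y, X', Y', rfl⟩ := exists_eq_lie W
  rw [map_add, map_add, lie_add, map_add, hlie, hlie]

/-! ### The operations on the multiplicity spaces. -/

theorem exists_act (hΦ : Φ.IsShort) (A : Φ.J₂) (b : Φ.J₁) :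
    ∃ c : Φ.J₁, ∀ (X : Sl2) (v : Fin 2 → ℂ), ⁅Φ.tmul₂ X A, Φ.tmul₁ v b⁆ =
      Φ.tmul₁ (Matrix.mulVec (X : Matrix (Fin 2) (Fin 2) ℂ) v) c := by
  refine exists_J₁_of_equivariant hΦ
    ((LieModule.toEnd ℂ 𝔤 𝔤).toLinearMap.compl₁₂ A.1 b.1) fun Z X v => ?_
  have h1 := A.2 Z X
  have h2 := b.2 Z v
  rw [← dΦ_apply] at h1 h2
  change Φ.dΦ Z ⁅A.1 X, b.1 v⁆ = ⁅A.1 ⁅Z, X⁆, b.1 v⁆ + ⁅A.1 X, b.1 _⁆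
  rw [dΦ_leibniz, h1, h2]

theorem exists_mul_Delta (hΦ : Φ.IsShort) (A B : Φ.J₂) :
    ∃ (C : Φ.J₂) (δ : Φ.g₀), ∀ X Y : Sl2, ⁅Φ.tmul₂ X A, Φ.tmul₂ Y B⁆ = Φ.tmul₂ ⁅X, Y⁆ C +
      (1 / 2 * Matrix.trace ((X : Matrix (Fin 2) (Fin 2) ℂ) *
        (Y : Matrix (Fin 2) (Fin 2) ℂ))) • (δ : 𝔤) := by
  refine exists_J₂_g₀_of_equivariant hΦ
    ((LieModule.toEnd ℂ 𝔤 𝔤).toLinearMap.compl₁₂ A.1 B.1) fun Z X Y => ?_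
  have h1 := A.2 Z X
  have h2 := B.2 Z Y
  rw [← dΦ_apply] at h1 h2
  change Φ.dΦ Z ⁅A.1 X, B.1 Y⁆ = ⁅A.1 ⁅Z, X⁆, B.1 Y⁆ + ⁅A.1 X, B.1 ⁅Z, Y⁆⁆
  rw [dΦ_leibniz, h1, h2]

theorem tmul₁_add (v : Fin 2 → ℂ) (a b : Φ.J₁) :
    Φ.tmul₁ v (a + b) = Φ.tmul₁ v a + Φ.tmul₁ v b := rfl

theorem tmul₁_smul (v : Fin 2 → ℂ) (r : ℂ) (a : Φ.J₁) :
    Φ.tmul₁ v (r • a) = r • Φ.tmul₁ v a := rfl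

theorem tmul₂_add (X : Sl2) (A B : Φ.J₂) : Φ.tmul₂ X (A + B) = Φ.tmul₂ X A + Φ.tmul₂ X B := rfl

theorem tmul₂_smul (X : Sl2) (r : ℂ) (A : Φ.J₂) : Φ.tmul₂ X (r • A) = r • Φ.tmul₂ X A := rfl

/-- The components are chosen for each pair separately. Their uniqueness then transfers bilinearity
from the bracket. -/
theorem exists_operations (hΦ : Φ.IsShort) : Nonempty Φ.Operations := by
  choose act hact using exists_act hΦ
  choose mul Delta hmul using exists_mul_Delta hΦ
  have hadd_left : ∀ A A' B, mul (A + A') B = mul A B + mul A' B ∧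
      Delta (A + A') B = Delta A B + Delta A' B := fun A A' B => tmul₂_add_smul_ext fun X Y => by
    rw [← hmul, tmul₂_add, add_lie, hmul, hmul, tmul₂_add, Submodule.coe_add]
    module
  have hsmul_left : ∀ (r : ℂ) A B, mul (r • A) B = r • mul A B ∧
      Delta (r • A) B = r • Delta A B := fun r A B => tmul₂_add_smul_ext fun X Y => by
    rw [← hmul, tmul₂_smul, smul_lie, hmul, tmul₂_smul, Submodule.coe_smul]
    module
  have hadd_right : ∀ A B B', mul A (B + B') = mul A B + mul A B' ∧
      Delta A (B + B') = Delta A B + Delta A B' := fun A B B' => tmul₂_add_smul_ext fun X Y => by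
    rw [← hmul, tmul₂_add, lie_add, hmul, hmul, tmul₂_add, Submodule.coe_add]
    module
  have hsmul_right : ∀ (r : ℂ) A B, mul A (r • B) = r • mul A B ∧
      Delta A (r • B) = r • Delta A B := fun r A B => tmul₂_add_smul_ext fun X Y => by
    rw [← hmul, tmul₂_smul, lie_smul, hmul, tmul₂_smul, Submodule.coe_smul]
    module
  exact ⟨{
    act := LinearMap.mk₂ ℂ act
      (fun A A' b => tmul₁_ext fun X v => by
        rw [← hact, tmul₂_add, add_lie, hact, hact, tmul₁_add])
      (fun r A b => tmul₁_ext fun X v => by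
        rw [← hact, tmul₂_smul, smul_lie, hact, tmul₁_smul])
      (fun A b b' => tmul₁_ext fun X v => by
        rw [← hact, tmul₁_add, lie_add, hact, hact, tmul₁_add])
      (fun r A b => tmul₁_ext fun X v => by
        rw [← hact, tmul₁_smul, lie_smul, hact, tmul₁_smul])
    mul := LinearMap.mk₂ ℂ mul (fun A A' B => (hadd_left A A' B).1)
      (fun r A B => (hsmul_left r A B).1) (fun A B B' => (hadd_right A B B').1)
      (fun r A B => (hsmul_right r A B).1)
    Delta := LinearMap.mk₂ ℂ Delta (fun A A' B => (hadd_left A A' B).2)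
      (fun r A B => (hsmul_left r A B).2) (fun A B B' => (hadd_right A B B').2)
      (fun r A B => (hsmul_right r A B).2)
    lie_tmul₂_tmul₁ := fun X A v b => hact A b X v
    lie_tmul₂_tmul₂ := fun X Y A B => hmul A B X Y }⟩

theorem Operations.unique (O O' : Φ.Operations) : O = O' := by
  have hact : O.act = O'.act := LinearMap.ext₂ fun A b => tmul₁_ext fun X v => by
    rw [← O.lie_tmul₂_tmul₁, ← O'.lie_tmul₂_tmul₁]
  have h2 : ∀ A B, O.mul A B = O'.mul A B ∧ O.Delta A B = O'.Delta A B := fun A B =>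
    tmul₂_add_smul_ext fun X Y => by rw [← O.lie_tmul₂_tmul₂, ← O'.lie_tmul₂_tmul₂]
  have hmul : O.mul = O'.mul := LinearMap.ext₂ fun A B => (h2 A B).1
  have hDelta : O.Delta = O'.Delta := LinearMap.ext₂ fun A B => (h2 A B).2
  cases O
  cases O'
  simp only at hact hmul hDelta
  subst hact hmul hDelta
  rfl

/-! ### The unit element. -/

variable (Φ) in
/-- `dΦ` is inner: it is induced by an equivariant map `𝔰𝔩₂ → 𝔤`. -/
theorem exists_lie_eq_dΦ [LieAlgebra.IsSimple ℂ 𝔤] :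
    ∃ I : Φ.J₂, ∀ (X : Sl2) (x : 𝔤), ⁅Φ.tmul₂ X I, x⁆ = Φ.dΦ X x := by
  have hinner : ∀ X : Sl2, ∃ y : 𝔤, ∀ x, ⁅y, x⁆ = Φ.dΦ X x := by
    intro X
    let D : LieDerivation ℂ 𝔤 𝔤 :=
      { Φ.dΦ X with
        leibniz' := fun a b => by
          change Φ.dΦ X ⁅a, b⁆ = ⁅a, Φ.dΦ X b⁆ - ⁅b, Φ.dΦ X a⁆
          rw [dΦ_leibniz, ← lie_skew b]
          abel }
    obtain ⟨y, hy⟩ := LieDerivation.IsKilling.exists_eq_ad D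
    exact ⟨y, fun x => (by simp : ⁅y, x⁆ = LieDerivation.ad ℂ 𝔤 y x).trans
      (LieDerivation.congr_fun hy x)⟩
  -- Triviality of the center makes the inner representative unique, hence linear and equivariant in
  -- `X`.
  have hinj : ∀ y z : 𝔤, (∀ x : 𝔤, ⁅y, x⁆ = ⁅z, x⁆) → y = z := by
    intro y z hyz
    have hc : y - z ∈ LieAlgebra.center ℂ 𝔤 := by
      rw [LieModule.mem_maxTrivSubmodule]
      intro x
      rw [← lie_skew, sub_lie, hyz, sub_self, neg_zero]
    rw [LieAlgebra.center_eq_bot, LieSubmodule.mem_bot] at hc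
    exact sub_eq_zero.1 hc
  choose j hj using hinner
  let I : Sl2 →ₗ[ℂ] 𝔤 :=
    { toFun := j
      map_add' := fun X Y => hinj _ _ fun x => by
        rw [hj, add_lie, hj, hj, map_add, LinearMap.add_apply]
      map_smul' := fun r X => hinj _ _ fun x => by
        rw [hj, RingHom.id_apply, smul_lie, hj, map_smul, LinearMap.smul_apply] }
  refine ⟨⟨I, fun X Y => hinj _ _ fun x => ?_⟩, hj⟩
  change ⁅Φ.dΦ X (j Y), x⁆ = ⁅j ⁅X, Y⁆, x⁆
  rw [← hj X, hj ⁅X, Y⁆, lie_lie, hj, hj, hj, hj, dΦ_lie]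

end SL2Structure

theorem mainTheorem4 {𝔤 : Type*} [LieRing 𝔤] [LieAlgebra ℂ 𝔤] [FiniteDimensional ℂ 𝔤]
    [LieAlgebra.IsSimple ℂ 𝔤] (Φ : SL2Structure 𝔤) (hΦ : Φ.IsShort) :
    ∃ O : Φ.Operations, (∀ O' : Φ.Operations, O' = O) ∧
      ∃ I : Φ.J₂, O.IsUnitElement I ∧ (∀ I' : Φ.J₂, O.IsUnitElement I' → I' = I) ∧
        ∀ a : Φ.J₁, O.act I a = a := by
  obtain ⟨O⟩ := SL2Structure.exists_operations hΦ
  obtain ⟨I, hI⟩ := Φ.exists_lie_eq_dΦ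
  have hunit : O.IsUnitElement I := fun A => ⟨?_, ?_⟩
  · refine ⟨O, fun O' => O'.unique O, I, hunit, fun I' hI' => ?_, fun a => ?_⟩
    · exact (hunit I').2.symm.trans (hI' I).1
    · refine SL2Structure.tmul₁_ext fun X v => ?_
      rw [← O.lie_tmul₂_tmul₁, hI]
      exact a.2 X v
  -- Here `[X ⊗ I, Y ⊗ A] = dΦ(X)(Y ⊗ A) = [X, Y] ⊗ A` has no trace term, so the comparison is made
  -- with `δ' = 0`.
  · refine (SL2Structure.tmul₂_add_smul_ext (δ := O.Delta I A) (δ' := 0) fun X Y => ?_).1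
    rw [← O.lie_tmul₂_tmul₂, hI, ZeroMemClass.coe_zero, smul_zero, add_zero]
    exact A.2 X Y
  · refine (SL2Structure.tmul₂_add_smul_ext (δ := O.Delta A I) (δ' := 0) fun X Y => ?_).1
    rw [← O.lie_tmul₂_tmul₂, ← lie_skew, hI, ZeroMemClass.coe_zero, smul_zero, add_zero,
      ← lie_skew X Y, SL2Structure.tmul₂, SL2Structure.tmul₂, map_neg]
    exact congrArg Neg.neg (A.2 Y X)
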